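/- **Definitions.** A cardinal $\kappa$ is *subtle* if for every closed unbounded $C\subseteq\kappa$ and every sequence $\langle A_\alpha\mid\alpha\in C\rangle$ with $A_\alpha\subseteq\alpha$ there are $\alpha<\beta$ in $C$ with $A_\alpha=A_\beta\cap\alpha$. Fix a finite fragment $\mathrm{ZFC}^*$ of $\mathrm{ZFC}$. For a cardinal $\gamma$, a *$\gamma$-model of set theory* is a transitive set $M$ of size $\gamma$ with $\gamma\in M$, $\langle M,\in\rangle\models\mathrm{ZFC}^*$ and $M^{<\gamma}\subseteq M$. A cardinal $\gamma$ is *$\theta$-strongly unfoldable* if it is (strongly) inaccessible and for every $\gamma$-model of set theory $M$ there are a transitive set $N$ with $V_\theta\subseteq N$ and an elementary embedding $j:M\to N$ with critical point $\gamma$ and $j(\gamma)\ge\theta$. It is *${<}\mu$-strongly unfoldable* if it is $\theta$-strongly unfoldable for every $\theta<\mu$, and *strongly unfoldable* if it is $\theta$-strongly unfoldable for every ordinal $\theta$. **Theorem.** For all sufficiently large finite fragments $\mathrm{ZFC}^*$ of $\mathrm{ZFC}$ (that is, there is a finite $T_0\subseteq\mathrm{ZFC}$ such that this holds for every finite $\mathrm{ZFC}^*$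 with $T_0\subseteq\mathrm{ZFC}^*\subseteq\mathrm{ZFC}$), the following holds for every subtle cardinal $\kappa$: 1. the set of cardinals $\gamma<\kappa$ that are ${<}\kappa$-strongly unfoldable is stationary in $\kappa$; 2. $V_\kappa$ has a stationary proper class of strongly unfoldable cardinals: the set of $\gamma<\kappa$ such that $V_\kappa\models{}$"$\gamma$ is strongly unfoldable" meets every closed unbounded subset of $\kappa$ and is unbounded in $\kappa$. -/

import Mathlib

open FirstOrder FirstOrder.Language Set
open scoped ZFSet

universe u

/-! ### The language of set theory and the axioms of ZFC -/

/-- The only non-logical symbol of the language of set theory: the binary relation `∈`. -/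
inductive SetLangRel : ℕ → Type
  | mem : SetLangRel 2

/-- The first-order language of set theory. -/
def setLang : FirstOrder.Language.{0, 0} := ⟨fun _ => Empty, SetLangRel⟩

/-- The symbol `∈`. -/
abbrev memSymb : setLang.Relations 2 := SetLangRel.mem

namespace SetAxioms

/-- The atomic formula `s ∈ t`. -/
def memF {α : Type} {n : ℕ} (s t : setLang.Term (α ⊕ Fin n)) : setLang.BoundedFormula α n :=
  Relations.boundedFormula₂ memSymb s t

/-- `φ`, with its free variables replaced by the quantifiable variables that `g` prescribes. -/
def subst {α : Type} {m : ℕ} (φ : setLang.Formula α) (g : α → Fin m) :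
    setLang.BoundedFormula Empty m :=
  BoundedFormula.relabel (k := 0) (fun i => (Sum.inr (g i) : Empty ⊕ Fin m)) φ

/-- Extensionality. (In all the formulas below the variable `&i` is the one that is bound by the
quantifier at depth `i`.) -/
def extensionality : setLang.Sentence :=
  ∀' ∀' ((∀' (memF &2 &0 ⇔ memF &2 &1)) ⟹ (&0 =' &1))

/-- Foundation: a set with an element has an `∈`-minimal element. -/
def foundation : setLang.Sentence :=
  ∀' ((∃' memF &1 &0) ⟹ ∃' (memF &1 &0 ⊓ ∼(∃' (memF &2 &1 ⊓ memF &2 &0))))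

/-- Pairing. -/
def pairing : setLang.Sentence :=
  ∀' ∀' ∃' ∀' (memF &3 &2 ⇔ ((&3 =' &0) ⊔ (&3 =' &1)))

/-- Union. -/
def union : setLang.Sentence :=
  ∀' ∃' ∀' (memF &2 &1 ⇔ ∃' (memF &3 &0 ⊓ memF &2 &3))

/-- Power set. -/
def powerSet : setLang.Sentence :=
  ∀' ∃' ∀' (memF &2 &1 ⇔ ∀' (memF &3 &2 ⟹ memF &3 &0))

/-- Infinity: some set contains the empty set and, with each `x`, also `x ∪ {x}`. -/
def infinity : setLang.Sentence :=
  ∃' ((∃' (memF &1 &0 ⊓ ∀' ∼(memF &2 &1))) ⊓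
    ∀' (memF &1 &0 ⟹ ∃' (memF &2 &0 ⊓ ∀' (memF &3 &2 ⇔ (memF &3 &1 ⊔ (&3 =' &1))))))

/-- Choice: for every set of nonempty pairwise disjoint sets there is a set that meets each of them
in exactly one point. -/
def choice : setLang.Sentence :=
  ∀' (((∀' (memF &1 &0 ⟹ ∃' memF &2 &1)) ⊓
      ∀' ∀' ((memF &1 &0 ⊓ (memF &2 &0 ⊓ ∃' (memF &3 &1 ⊓ memF &3 &2))) ⟹ (&1 =' &2))) ⟹
    ∃' ∀' (memF &2 &0 ⟹ ∃' ∀' ((memF &4 &1 ⊓ memF &4 &2) ⇔ (&4 =' &3))))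

/-- The instance of the separation schema for `φ(p₁, …, pₙ, z)`:
`∀ p⃗ ∀ a ∃ b ∀ z (z ∈ b ↔ z ∈ a ∧ φ(p⃗, z))`. -/
def separation {n : ℕ} (φ : setLang.Formula (Fin n ⊕ Fin 1)) : setLang.Sentence :=
  BoundedFormula.alls (n := n) <| ∀' ∃' ∀'
    (memF &(Fin.natAdd n (2 : Fin 3)) &(Fin.natAdd n (1 : Fin 3)) ⇔
      (memF &(Fin.natAdd n (2 : Fin 3)) &(Fin.natAdd n (0 : Fin 3)) ⊓
        subst φ (Sum.elim (Fin.castAdd 3) ![Fin.natAdd n (2 : Fin 3)])))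

/-- The instance of the replacement schema for `φ(p₁, …, pₙ, x, y)`:
`∀ p⃗ ∀ a (∀ x (x ∈ a → ∃! y φ(p⃗, x, y)) → ∃ b ∀ x (x ∈ a → ∃ y (y ∈ b ∧ φ(p⃗, x, y))))`. -/
def replacement {n : ℕ} (φ : setLang.Formula (Fin n ⊕ Fin 2)) : setLang.Sentence :=
  BoundedFormula.alls (n := n) <| ∀'
    ((∀' (memF &(Fin.natAdd n (1 : Fin 2)) &(Fin.natAdd n (0 : Fin 2)) ⟹ ∃' ∀'
        (subst φ (Sum.elim (Fin.castAdd 4) ![Fin.natAdd n (1 : Fin 4), Fin.natAdd n (3 : Fin 4)]) ⇔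
          (&(Fin.natAdd n (3 : Fin 4)) =' &(Fin.natAdd n (2 : Fin 4)))))) ⟹
      ∃' ∀' (memF &(Fin.natAdd n (2 : Fin 3)) &(Fin.natAdd n (0 : Fin 3)) ⟹ ∃'
        (memF &(Fin.natAdd n (3 : Fin 4)) &(Fin.natAdd n (1 : Fin 4)) ⊓
          subst φ (Sum.elim (Fin.castAdd 4) ![Fin.natAdd n (2 : Fin 4), Fin.natAdd n (3 : Fin 4)]))))

end SetAxioms

open SetAxioms in
/-- The axioms of ZFC. -/
def ZFC : setLang.Theory :=
  {extensionality, foundation, pairing, union, powerSet, infinity, choice} ∪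
    {σ | ∃ (n : ℕ) (φ : setLang.Formula (Fin n ⊕ Fin 1)), σ = separation φ} ∪
    {σ | ∃ (n : ℕ) (φ : setLang.Formula (Fin n ⊕ Fin 2)), σ = replacement φ}

/-- A set `M` as a structure `⟨M, ∈⟩` for the language of set theory. -/
instance setStructure (M : ZFSet.{u}) : setLang.Structure M where
  funMap := fun f => Empty.elim f
  RelMap := fun r => match r with
    | SetLangRel.mem => fun v => (v 0 : ZFSet.{u}) ∈ (v 1 : ZFSet.{u})

/-! ### Subtle cardinals -/

/-- `κ` is subtle: for every closed unbounded `C ⊆ κ` and every sequence `⟨A_α | α ∈ C⟩` with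
`A_α ⊆ α` there are `α < β` in `C` with `A_α = A_β ∩ α`. -/
def IsSubtle (κ : Cardinal.{u}) : Prop :=
  ∀ C : Set (Iio κ.ord), IsClub C →
    ∀ A : Iio κ.ord → Set Ordinal.{u}, (∀ α ∈ C, A α ⊆ Iio (α : Ordinal.{u})) →
      ∃ α ∈ C, ∃ β ∈ C, α < β ∧ A α = A β ∩ Iio (α : Ordinal.{u})

/-! ### Strongly unfoldable cardinals -/

/-- `M` is a `κ`-model of set theory, where `T` is the chosen fragment of ZFC: `M` is transitive of
size `κ`, contains `κ`, satisfies `T`, and contains every sequence of elements of `M` of length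
less than `κ`. -/
structure IsKappaModel (T : setLang.Theory) (κ : Cardinal.{u}) (M : ZFSet.{u}) : Prop where
  transitive : M.IsTransitive
  card_eq : M.card = κ
  mem : κ.ord.toZFSet ∈ M
  models : M ⊨ T
  closed : ∀ α < κ.ord, ∀ s : ZFSet.{u}, ZFSet.IsFunc α.toZFSet M s → s ∈ M

/-- The ordinal `κ` is the critical point of `j : M → N`: the least ordinal that `j` moves. -/
def IsCriticalPoint {M N : ZFSet.{u}} (j : M ↪ₑ[setLang] N) (κ : Ordinal.{u}) : Prop :=
  (∃ h : κ.toZFSet ∈ M, (j ⟨κ.toZFSet, h⟩ : ZFSet.{u}) ≠ κ.toZFSet) ∧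
    ∀ α < κ, ∀ h : α.toZFSet ∈ M, (j ⟨α.toZFSet, h⟩ : ZFSet.{u}) = α.toZFSet

/-- `j : M → N` is a `θ`-unfoldability embedding for `κ`: `N` is transitive, and the elementary
embedding `j` has critical point `κ` and `j(κ) ≥ θ`. -/
structure IsUnfoldabilityEmbedding (κ θ : Ordinal.{u}) {M N : ZFSet.{u}}
    (j : M ↪ₑ[setLang] N) : Prop where
  transitive : N.IsTransitive
  crit : IsCriticalPoint j κ
  le_image : ∀ h : κ.toZFSet ∈ M, θ.toZFSet ⊆ (j ⟨κ.toZFSet, h⟩ : ZFSet.{u})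

/-- `κ` is `θ`-strongly unfoldable: `κ` is inaccessible and every `κ`-model `M` has a
`θ`-unfoldability embedding `j : M → N` with `V_θ ⊆ N`. (Inaccessibility is part of the notion: for
a singular cardinal, say, there are no `κ`-models, and the second clause holds vacuously.) -/
def IsThetaStronglyUnfoldable (T : setLang.Theory) (κ : Cardinal.{u}) (θ : Ordinal.{u}) : Prop :=
  κ.IsInaccessible ∧
    ∀ M : ZFSet.{u}, IsKappaModel T κ M →
      ∃ (N : ZFSet.{u}) (j : M ↪ₑ[setLang] N),
        IsUnfoldabilityEmbedding κ.ord θ j ∧ V_ θ ⊆ N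

/-- `κ` is `<μ`-strongly unfoldable: it is `θ`-strongly unfoldable for every `θ < μ`. -/
def IsLTStronglyUnfoldable (T : setLang.Theory) (κ : Cardinal.{u}) (μ : Ordinal.{u}) : Prop :=
  ∀ θ < μ, IsThetaStronglyUnfoldable T κ θ

/-! ### Strong unfoldability inside a transitive class

The definitions above, evaluated in a transitive class `W`: all quantifiers over sets range over
`W`. Being an ordinal, the rank of a set, `M ⊨ T` and the elementarity of a map between sets are
absolute and are left as they are. -/

/-- `W` believes that the ordinal `γ` is an inaccessible cardinal: `γ` is uncountable, no function
in `W` from a smaller ordinal to `γ` is unbounded, and no (partial) function in `W` maps the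
subsets of a smaller ordinal onto `γ`. -/
structure IsInaccessibleIn (W : Set ZFSet.{u}) (γ : Ordinal.{u}) : Prop where
  mem : γ.toZFSet ∈ W
  omega_lt : Ordinal.omega0 < γ
  regular : ∀ α < γ, ∀ f ∈ W, ZFSet.IsFunc α.toZFSet γ.toZFSet f →
    ∃ β < γ, ∀ x y, ZFSet.pair x y ∈ f → y ∈ β.toZFSet
  strongLimit : ∀ α < γ, ¬ ∃ f ∈ W,
    (∀ x y y', ZFSet.pair x y ∈ f → ZFSet.pair x y' ∈ f → y = y') ∧
      ∀ β < γ, ∃ x ∈ W, x ⊆ α.toZFSet ∧ ZFSet.pair x β.toZFSet ∈ f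

/-- `W` believes that `M` is a `γ`-model of set theory. -/
structure IsKappaModelIn (T : setLang.Theory) (W : Set ZFSet.{u}) (γ : Ordinal.{u})
    (M : ZFSet.{u}) : Prop where
  mem_class : M ∈ W
  transitive : M.IsTransitive
  card_eq : ∃ b ∈ W, ZFSet.IsFunc γ.toZFSet M b ∧ ∀ y ∈ M, ∃! x, ZFSet.pair x y ∈ b
  mem : γ.toZFSet ∈ M
  models : M ⊨ T
  closed : ∀ α < γ, ∀ s ∈ W, ZFSet.IsFunc α.toZFSet M s → s ∈ M

/-- `W` believes that `γ` is `θ`-strongly unfoldable. -/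
def IsThetaStronglyUnfoldableIn (T : setLang.Theory) (W : Set ZFSet.{u}) (γ θ : Ordinal.{u}) :
    Prop :=
  IsInaccessibleIn W γ ∧
    ∀ M ∈ W, IsKappaModelIn T W γ M →
      ∃ N ∈ W, ∃ j : M ↪ₑ[setLang] N,
        (∃ g ∈ W, ∀ p, p ∈ g ↔ ∃ x : M, p = ZFSet.pair (x : ZFSet.{u}) (j x)) ∧
          IsUnfoldabilityEmbedding γ θ j ∧ ∀ x ∈ W, x.rank < θ → x ∈ N

/-- `W` believes that `γ` is strongly unfoldable: `θ`-strongly unfoldable for every ordinal `θ`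
of `W`. -/
def IsStronglyUnfoldableIn (T : setLang.Theory) (W : Set ZFSet.{u}) (γ : Ordinal.{u}) : Prop :=
  ∀ θ : Ordinal.{u}, θ.toZFSet ∈ W → IsThetaStronglyUnfoldableIn T W γ θ

/-! Suppose a club contains no cardinal of the required kind. Thin it out to uncountable strong
limit cardinals γ and attach to each a set A_γ of tagged finite sequences below γ. If γ is singular,
A_γ codes a cofinal map from a shorter ordinal. Otherwise γ is inaccessible, some θ_γ < κ and some
γ-model M_γ witness the failure, and A_γ is the elementary diagram of M_γ with elements named by
ordinals below γ.

Subtlety, applied to points closed under θ, yields α < β such that A_α is the restriction of A_β to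
α. Coherent cofinal maps are impossible and the two kinds of code do not mix, so M_α embeds
elementarily into M_β, with α sent to β > θ_α and smaller ordinals fixed. M_β contains V_β, hence
V_{θ_α}: a contradiction. As M_β has size β, it lies in V_κ, so the same argument works inside V_κ.

The main ingredients are `IsSubtle.isInaccessible`, `IsSubtle.exists_lt_of_list` (subtlety for
finite sequences), `IsKappaModel.mem_of_rank_lt` (the only use of axioms of `T`) and
`exists_embedding_of_modelCode`. -/

/-! ### Clubs in a regular cardinal -/

open Cardinal Order in
/-- A subset of a regular cardinal of smaller size is bounded. -/
theorem Cardinal.IsRegular.exists_forall_lt {κ : Cardinal.{u}} (hκ : κ.IsRegular)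
    {s : Set (Iio κ.ord)} (hs : #s < Cardinal.lift.{u + 1} κ) : ∃ b, ∀ x ∈ s, x < b := by
  have h : Order.cof (Iio κ.ord) = Cardinal.lift.{u + 1} κ := by
    rw [Ordinal.cof_Iio, ← Ordinal.lift_cof, hκ.cof_ord]
  by_contra! H
  exact (cof_le (s := s) H).not_gt (h ▸ hs)

theorem mk_Iio_subtype_lt {κ : Cardinal.{u}} (α : Iio κ.ord) :
    Cardinal.mk (Iio α) < Cardinal.lift.{u + 1} κ := by
  have h : Cardinal.mk (Iio α) ≤ Cardinal.mk (Iio (α : Ordinal.{u})) :=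
    Cardinal.mk_le_of_injective (f := fun x : Iio α => (⟨x.1.1, x.2⟩ : Iio (α : Ordinal.{u})))
      (fun x y hxy => by simpa [Subtype.ext_iff] using hxy)
  refine h.trans_lt ?_
  rw [Cardinal.mk_Iio_ordinal, Cardinal.lift_lt]
  exact Cardinal.lt_ord.1 α.2

theorem exists_isLUB_of_forall_lt {X : Type*} [LinearOrder X] [WellFoundedLT X] {s : Set X} {b : X}
    (h : ∀ x ∈ s, x < b) : ∃ a, IsLUB s a :=
  ⟨wellFounded_lt.min (upperBounds s) ⟨b, fun x hx => (h x hx).le⟩,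
    WellFounded.min_mem _ _ _, fun _ hc => WellFounded.min_le _ hc⟩

theorem Cardinal.noMaxOrder_Iio_ord {κ : Cardinal.{u}} (h0 : Cardinal.aleph0 ≤ κ) :
    NoMaxOrder (Iio κ.ord) :=
  ⟨fun x => ⟨⟨x + 1, (Cardinal.isSuccLimit_ord h0).add_one_lt x.2⟩,
    by simp [← Subtype.coe_lt_coe]⟩⟩

/-- The closure points of a function on an uncountable regular cardinal form a club. -/
theorem isClub_closurePoints {κ : Cardinal.{u}} (hκ : κ.IsRegular) (h0 : Cardinal.aleph0 < κ)
    (f : Iio κ.ord → Iio κ.ord) : IsClub {α | ∀ δ < α, f δ < α} := by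
  refine ⟨fun d hd _ _ a ha δ hδ => ?_, fun a => ?_⟩
  · obtain ⟨x, hx, hδx⟩ := (lt_isLUB_iff ha).1 hδ
    exact (hd hx δ hδx).trans_le (ha.1 hx)
  · have := Cardinal.noMaxOrder_Iio_ord h0.le
    have step (x : Iio κ.ord) : ∃ b, x < b ∧ ∀ y ≤ x, f y < b := by
      obtain ⟨x', hx'⟩ := exists_gt x
      obtain ⟨b, hb⟩ := hκ.exists_forall_lt (s := f '' Iio x')
        (Cardinal.mk_image_le.trans_lt (mk_Iio_subtype_lt x'))
      exact ⟨max b x', lt_max_of_lt_right hx', fun y hy =>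
        lt_max_of_lt_left (hb _ ⟨y, hy.trans_lt hx', rfl⟩)⟩
    choose g hg hfg using step
    -- The supremum of the ω iterates of `g` is a closure point; it is below κ because κ is regular
    -- and uncountable.
    obtain ⟨b, hb⟩ := hκ.exists_forall_lt (s := range fun n : ℕ => g^[n] a) (by
      refine (Cardinal.mk_le_aleph0_iff.2 (countable_range _).to_subtype).trans_lt ?_
      simpa using h0)
    obtain ⟨α, hα⟩ := exists_isLUB_of_forall_lt hb
    refine ⟨α, fun δ hδ => ?_, hα.1 ⟨0, rfl⟩⟩
    obtain ⟨_, ⟨n, rfl⟩, hn⟩ := (lt_isLUB_iff hα).1 hδ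
    refine (hfg _ δ hn.le).trans_le (hα.1 ⟨n + 1, ?_⟩)
    simp [Function.iterate_succ_apply']

theorem isClub_Ioi {X : Type*} [LinearOrder X] [NoMaxOrder X] (a : X) : IsClub (Ioi a) := by
  refine ⟨fun d hd hne _ x hx => ?_, fun b => ?_⟩
  · obtain ⟨y, hy⟩ := hne
    exact (hd hy).trans_le (hx.1 hy)
  · obtain ⟨c, hc⟩ := exists_gt (max a b)
    exact ⟨c, (le_max_left a b).trans_lt hc, (le_max_right a b).trans hc.le⟩

/-! ### Subtle cardinals are inaccessible -/

theorem IsSubtle.aleph0_lt {κ : Cardinal.{u}} (h : IsSubtle κ) : Cardinal.aleph0 < κ := by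
  by_contra! hκ
  -- This removes 0 unless 0 is the largest element, so that the case κ = 1 still gives a club. A
  -- nonzero finite ordinal is determined by its predecessor, so the sets of predecessors cannot
  -- cohere.
  have hC : IsClub {x : Iio κ.ord | (x : Ordinal.{u}) = 0 → ∀ y, y ≤ x} := by
    refine ⟨fun d hd hne _ x hx h0 => ?_, fun a => ?_⟩
    · obtain ⟨y, hy⟩ := hne
      have hyx := hx.1 hy
      obtain rfl : y = x := hyx.antisymm (by simp [← Subtype.coe_le_coe, h0])
      exact hd hy h0
    · by_cases ha : ∃ b, a < b
      · obtain ⟨b, hb⟩ := ha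
        refine ⟨b, fun h0 => ?_, hb.le⟩
        simp [← Subtype.coe_lt_coe, h0] at hb
      · push Not at ha
        exact ⟨a, fun _ => ha, le_rfl⟩
  obtain ⟨α, hα, β, -, hlt, heq⟩ := h _ hC (fun x => {y | y + 1 = (x : Ordinal.{u})})
    (fun x _ y hy => by rw [mem_Iio, ← (show y + 1 = (x : Ordinal.{u}) from hy)]; simp)
  have hα0 : (α : Ordinal.{u}) ≠ 0 := fun h0 => (hα h0 β).not_gt hlt
  have hαω : (α : Ordinal.{u}) < Ordinal.omega0 :=
    α.2.trans_le (by simpa using Cardinal.ord_le_ord.2 hκ)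
  obtain ⟨n, hn⟩ := Ordinal.lt_omega0.1 hαω
  obtain _ | n := n
  · simp [hn] at hα0
  have hm : (n : Ordinal.{u}) ∈ {y | y + 1 = (α : Ordinal.{u})} := by simp [hn]
  rw [heq] at hm
  have h1 : (n : Ordinal.{u}) + 1 = β := hm.1
  have h2 : (n : Ordinal.{u}) + 1 = α := by simp [hn]
  exact hlt.ne (Subtype.ext (h2.symm.trans h1))

/-- If κ ≤ 2^x, attach distinct subsets of x to the ordinals above x. Intersecting with such an
ordinal changes nothing, so coherence contradicts distinctness. -/
theorem IsSubtle.isStrongPrelimit {κ : Cardinal.{u}} (h : IsSubtle κ) : κ.IsStrongPrelimit := by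
  intro x hx
  by_contra! hle
  have := Cardinal.noMaxOrder_Iio_ord h.aleph0_lt.le
  obtain ⟨f⟩ : Nonempty (Iio κ.ord ↪ Set (Iio x.ord)) := by
    rw [← Cardinal.le_def]
    simpa [Cardinal.mk_Iio_ordinal] using Cardinal.lift_le.{u + 1}.2 hle
  obtain ⟨α, hα, β, hβ, hlt, heq⟩ := h (Ioi ⟨x.ord, Cardinal.ord_lt_ord.2 hx⟩) (isClub_Ioi _)
    (fun α => Subtype.val '' (f α)) (by
      rintro α hα _ ⟨y, -, rfl⟩
      exact lt_trans (mem_Iio.1 y.2) (show x.ord < (α : Ordinal.{u}) from hα))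
  refine hlt.ne (f.injective (Subtype.val_injective.image_injective (heq.trans ?_)))
  refine inter_eq_left.2 ?_
  rintro _ ⟨y, -, rfl⟩
  exact lt_trans (mem_Iio.1 y.2) (show x.ord < (α : Ordinal.{u}) from hα)

theorem IsSubtle.isRegular {κ : Cardinal.{u}} (h : IsSubtle κ) : κ.IsRegular := by
  have := Cardinal.noMaxOrder_Iio_ord h.aleph0_lt.le
  refine ⟨h.aleph0_lt.le, ?_⟩
  by_contra! hμ
  have hcof : Order.cof (Iio κ.ord) = Cardinal.lift.{u + 1} κ.ord.cof := by
    rw [Ordinal.cof_Iio, ← Ordinal.lift_cof]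
  obtain ⟨S, hS, hcard⟩ := Order.exists_cof_eq (Iio κ.ord)
  set μ := κ.ord.cof
  obtain ⟨e⟩ : Nonempty (S ↪ Iio μ.ord) := by
    rw [← Cardinal.le_def, hcard, hcof]
    simp [Cardinal.mk_Iio_ordinal]
  let m : Iio κ.ord := ⟨μ.ord, Cardinal.ord_lt_ord.2 hμ⟩
  -- Above μ, these are the points of `S` and its limits. The set attached to `x` below records the
  -- least element `g x` of `S` above or equal to `x`, and uses the spare ordinal μ to mark whether
  -- `x ∈ S`.
  let C : Set (Iio κ.ord) := {x | m < x ∧ ∀ y < x, ∃ s ∈ S, y < s ∧ s ≤ x}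
  have hC : IsClub C := by
    refine ⟨fun d hd hne _ a ha => ⟨?_, fun y hy => ?_⟩, fun a => ?_⟩
    · obtain ⟨y, hy⟩ := hne
      exact (hd hy).1.trans_le (ha.1 hy)
    · obtain ⟨x, hx, hyx⟩ := (lt_isLUB_iff ha).1 hy
      obtain ⟨s, hs, h1, h2⟩ := (hd hx).2 y hyx
      exact ⟨s, hs, h1, h2.trans (ha.1 hx)⟩
    · obtain ⟨b, hb⟩ := exists_gt (max a m)
      obtain ⟨s, hs, hbs⟩ := hS b
      exact ⟨s, ⟨(le_max_right a m).trans_lt (hb.trans_le hbs), fun y hy => ⟨s, hs, hy, le_rfl⟩⟩,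
        (le_max_left a m).trans (hb.le.trans hbs)⟩
  have hex (x : Iio κ.ord) : {s : S | x ≤ s}.Nonempty := by
    obtain ⟨s, hs, hxs⟩ := hS x
    exact ⟨⟨s, hs⟩, hxs⟩
  let g (x : Iio κ.ord) : S := wellFounded_lt.min _ (hex x)
  have hg (x : Iio κ.ord) : x ≤ g x := wellFounded_lt.min_mem _ (hex x)
  have hg' (x : Iio κ.ord) (s : S) (hs : x ≤ s) : g x ≤ s :=
    WellFounded.min_le _ (show s ∈ {s : S | x ≤ s} from hs)
  obtain ⟨α, hα, β, hβ, hlt, heq⟩ := h C hC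
    (fun x => {y : Ordinal.{u} | y = (e (g x) : Ordinal.{u}) ∨ (y = μ.ord ∧ x ∈ S)}) (by
      rintro x ⟨hx, -⟩ y (rfl | ⟨rfl, -⟩)
      · exact lt_trans (mem_Iio.1 (e (g x)).2) hx
      · exact hx)
  have heq' : {y : Ordinal.{u} | y = (e (g α) : Ordinal.{u}) ∨ (y = μ.ord ∧ α ∈ S)} =
      {y : Ordinal.{u} | y = (e (g β) : Ordinal.{u}) ∨ (y = μ.ord ∧ β ∈ S)} := by
    refine heq.trans (inter_eq_left.2 ?_)
    rintro y (rfl | ⟨rfl, -⟩)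
    · exact lt_trans (mem_Iio.1 (e (g β)).2) hα.1
    · exact hα.1
  have key (x : Iio κ.ord) : ((e (g x) : Ordinal.{u})) ≠ μ.ord := (e (g x)).2.ne
  have hgg : g α = g β := by
    have := (Set.ext_iff.1 heq' (e (g α))).1 (Or.inl rfl)
    obtain h1 | h1 := this
    · exact e.injective (Subtype.ext h1)
    · exact (key α h1.1).elim
  have hSS : α ∈ S ↔ β ∈ S := by
    have := Set.ext_iff.1 heq' μ.ord
    simpa [(key _).symm] using this
  by_cases hαS : α ∈ S
  · have h1 := hg' α ⟨α, hαS⟩ le_rfl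
    have h2 : β ≤ α := (hg β).trans (hgg ▸ h1)
    exact h2.not_gt hlt
  -- No point of `S` lies strictly between α and `g β`, so the point found in (α, β] must be β
  -- itself; the marker then puts α in `S`.
  · obtain ⟨s, hs, h1, h2⟩ := hβ.2 α hlt
    have h3 : g α ≤ ⟨s, hs⟩ := hg' α ⟨s, hs⟩ h1.le
    have h4 : β ≤ s := (hg β).trans (hgg ▸ h3)
    obtain rfl := h2.antisymm h4
    exact hαS (hSS.2 hs)

theorem IsSubtle.isInaccessible {κ : Cardinal.{u}} (h : IsSubtle κ) : κ.IsInaccessible :=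
  ⟨h.aleph0_lt, h.isRegular.2, h.isStrongPrelimit⟩

/-! ### Subtlety for finite sequences -/

open Cardinal in
/-- Subtlety for sets of finite sequences of ordinals with tags from a countable set. -/
theorem IsSubtle.exists_lt_of_list {κ : Cardinal.{u}} (h : IsSubtle κ) {K : Type} [Countable K]
    {C : Set (Iio κ.ord)} (hC : IsClub C) (A : Iio κ.ord → Set (K × List (Iio κ.ord)))
    (hA : ∀ α ∈ C, ∀ x ∈ A α, ∀ ξ ∈ x.2, ξ < α) :
    ∃ α ∈ C, ∃ β ∈ C, α < β ∧ ∀ x, x ∈ A α ↔ x ∈ A β ∧ ∀ ξ ∈ x.2, ξ < α := by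
  have hreg := h.isRegular
  have hlim := Cardinal.noMaxOrder_Iio_ord h.aleph0_lt.le
  have hcof : Order.cof (Iio κ.ord) ≠ ℵ₀ := by
    rw [Ordinal.cof_Iio, ← Ordinal.lift_cof, hreg.cof_ord]
    simpa using h.aleph0_lt.ne'
  have hlist (J : Type (u + 1)) : #(K × List J) ≤ max ℵ₀ #J := by
    rw [mk_prod]
    refine (mul_le_max _ _).trans ?_
    simp only [max_le_iff, le_max_left, and_true]
    refine ⟨le_max_of_le_left ?_, ?_⟩
    · simp
    · rw [Cardinal.lift_id']; exact (mk_list_le_max J).trans (by simp)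
  have h0 : ℵ₀ < Cardinal.lift.{u + 1} κ := by simpa using h.aleph0_lt
  obtain ⟨c⟩ : Nonempty (K × List (Iio κ.ord) ↪ Iio κ.ord) := by
    rw [← Cardinal.le_def]
    refine (hlist _).trans (max_le ?_ le_rfl)
    simpa [mk_Iio_ordinal] using h0.le
  have hf (δ : Iio κ.ord) : ∃ b, ∀ x : K × List (Iio κ.ord), (∀ ξ ∈ x.2, ξ ≤ δ) → c x < b := by
    obtain ⟨δ', hδ'⟩ := exists_gt δ
    obtain ⟨b, hb⟩ := hreg.exists_forall_lt
      (s := range fun x : K × List (Iio δ') => c (x.1, x.2.map Subtype.val))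
      ((mk_range_le.trans (hlist _)).trans_lt (max_lt h0 (mk_Iio_subtype_lt δ')))
    refine ⟨b, fun x hx => hb _ ⟨(x.1, x.2.attach.map fun ξ => ⟨ξ.1, (hx _ ξ.2).trans_lt hδ'⟩), ?_⟩⟩
    simp only [List.map_map, Function.comp_def, List.attach_map_subtype_val]
  have hg (δ : Iio κ.ord) : ∃ b, ∀ x : K × List (Iio κ.ord), c x = δ → ∀ ξ ∈ x.2, ξ < b := by
    by_cases hx : ∃ x, c x = δ
    · obtain ⟨x, rfl⟩ := hx
      obtain ⟨b, hb⟩ := hreg.exists_forall_lt (s := {ξ | ξ ∈ x.2})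
        ((Cardinal.lt_aleph0_iff_set_finite.2 x.2.finite_toSet).trans h0)
      exact ⟨b, fun y hy => by rw [c.injective hy]; exact hb⟩
    · exact ⟨δ, fun x hx' => (hx ⟨x, hx'⟩).elim⟩
  choose f hf using hf
  choose g hg using hg
  let z : Iio κ.ord := ⟨0, h.isInaccessible.isRegular.ord_pos⟩
  have hD := ((hC.inter hcof (isClub_closurePoints hreg h.aleph0_lt f)).inter hcof
    (isClub_closurePoints hreg h.aleph0_lt g)).inter hcof (isClub_Ioi z)
  -- `f` bounds the codes of lists with bounded entries and `g` the entries of the list with a given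
  -- code. At common closure points, restricting codes to α is the same as restricting entries to α.
  have hkey : ∀ α ∈ C ∩ {α | ∀ δ < α, f δ < α} ∩ {α | ∀ δ < α, g δ < α} ∩ Ioi z,
      ∀ x, c x < α ↔ ∀ ξ ∈ x.2, ξ < α := by
    rintro α ⟨⟨⟨-, h1⟩, h2⟩, h3⟩ x
    refine ⟨fun hx ξ hξ => (hg _ x rfl ξ hξ).trans (h2 _ hx), fun hx => ?_⟩
    obtain ⟨δ, hδ, hδ'⟩ : ∃ δ < α, ∀ ξ ∈ x.2, ξ ≤ δ := by
      clear hA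
      obtain ⟨k, l⟩ := x
      simp only at hx ⊢
      induction l with
      | nil => exact ⟨z, h3, by simp⟩
      | cons a l ih =>
        simp only [List.mem_cons, forall_eq_or_imp] at hx ⊢
        obtain ⟨δ, hδ, hl⟩ := ih hx.2
        exact ⟨max a δ, max_lt hx.1 hδ, le_max_left _ _, fun ξ hξ => (hl ξ hξ).trans
          (le_max_right _ _)⟩
    exact (hf δ x hδ').trans (h1 δ hδ)
  obtain ⟨α, hα, β, hβ, hlt, heq⟩ := h _ hD (fun α => (fun x => (c x : Ordinal.{u})) '' A α) (by
    rintro α hα _ ⟨x, hx, rfl⟩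
    exact (hkey α hα x).2 (hA α hα.1.1.1 x hx))
  have hinj : Function.Injective fun x => (c x : Ordinal.{u}) :=
    Subtype.val_injective.comp c.injective
  refine ⟨α, hα.1.1.1, β, hβ.1.1.1, hlt, fun x => ?_⟩
  rw [← hkey α hα, ← hinj.mem_set_image (s := A α), heq, mem_inter_iff, hinj.mem_set_image]
  rfl

/-! ### κ-models contain V_κ -/

namespace SetAxioms

@[simp]
theorem realize_memF {M : ZFSet.{u}} {α : Type} {n : ℕ} (s t : setLang.Term (α ⊕ Fin n))
    (v : α → M) (xs : Fin n → M) :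
    (memF s t).Realize v xs ↔
      ((s.realize (Sum.elim v xs) : M) : ZFSet.{u}) ∈ ((t.realize (Sum.elim v xs) : M) : ZFSet.{u}) :=
  BoundedFormula.realize_rel₂

theorem realize_subst {M : ZFSet.{u}} {α : Type} {m : ℕ} (φ : setLang.Formula α) (g : α → Fin m)
    (v : Empty → M) (xs : Fin m → M) : (subst φ g).Realize v xs ↔ φ.Realize (xs ∘ g) := by
  have h : (Sum.elim v (xs ∘ Fin.castAdd 0) ∘ fun i => Sum.inr (g i)) = xs ∘ g := rfl
  have h' : xs ∘ Fin.natAdd m = (default : Fin 0 → M) := Subsingleton.elim _ _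
  rw [subst, BoundedFormula.realize_relabel, Formula.Realize, h, h']

/-- `z` is the second coordinate of a pair in `s`, where `s` is the parameter. -/
def sndCoord : setLang.Formula (Fin 1 ⊕ Fin 1) :=
  ∃' (memF &0 (Term.var (Sum.inl (Sum.inl 0))) ⊓
    ((∃' (memF &1 &0 ⊓ memF (Term.var (Sum.inl (Sum.inr 0))) &1)) ⊓
      ((∀' (memF &1 &0 ⟹ memF (Term.var (Sum.inl (Sum.inr 0))) &1)) ⟹
        ∀' (memF &1 &0 ⟹ ∀' (memF &2 &1 ⟹ (&2 =' Term.var (Sum.inl (Sum.inr 0))))))))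

end SetAxioms

open SetAxioms


theorem ZFSet.IsTransitive.sUnion_mem_of_models {M : ZFSet.{u}} (hM : M.IsTransitive)
    (h : M ⊨ SetAxioms.union) {a : ZFSet.{u}} (ha : a ∈ M) : (⋃₀ a : ZFSet.{u}) ∈ M := by
  simp [SetAxioms.union, Sentence.Realize, Formula.Realize, Fin.snoc] at h
  obtain ⟨b, hb, hab⟩ := h a ha
  convert hb using 1
  ext z
  rw [ZFSet.mem_sUnion]
  constructor
  · rintro ⟨y, hy, hz⟩
    have hyM := hM.mem_trans hy ha
    exact (hab z (hM.mem_trans hz hyM)).2 ⟨y, hy, hyM, hz⟩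
  · intro hz
    obtain ⟨y, hy, -, hz'⟩ := (hab z (hM.mem_trans hz hb)).1 hz
    exact ⟨y, hy, hz'⟩

theorem exists_sep_of_models {M : ZFSet.{u}} (φ : setLang.Formula (Fin 1 ⊕ Fin 1))
    (h : M ⊨ separation φ) (p a : M) :
    ∃ b : M, ∀ z : M, (z : ZFSet.{u}) ∈ (b : ZFSet.{u}) ↔ (z : ZFSet.{u}) ∈ (a : ZFSet.{u}) ∧
      φ.Realize (Sum.elim (fun _ => p) (fun _ => z)) := by
  rw [separation, Sentence.Realize, BoundedFormula.realize_alls] at h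
  obtain ⟨b, hb⟩ := BoundedFormula.realize_ex.1 (h ![p] a)
  refine ⟨b, fun z => ?_⟩
  have := hb z
  rw [BoundedFormula.realize_iff, BoundedFormula.realize_inf, realize_subst] at this
  refine (Iff.trans Iff.rfl this).trans (and_congr Iff.rfl ?_)
  rw [show (_ ∘ Sum.elim _ _ : Fin 1 ⊕ Fin 1 → M) = Sum.elim (fun _ => p) (fun _ => z) by
    ext (i | i) <;> fin_cases i <;> rfl]

/-- For p = {{x}, {x, y}}, membership of z in some element of p gives z = x or z = y. If z lies in
all elements of p, then z = x, and the last clause forces y = z too. -/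
theorem realize_sndCoord {M : ZFSet.{u}} (hM : M.IsTransitive) {s z : M}
    (hs : ∀ p ∈ (s : ZFSet.{u}), ∃ x y, p = ZFSet.pair x y) :
    sndCoord.Realize (Sum.elim (fun _ => s) (fun _ => z)) ↔
      ∃ x, ZFSet.pair x z ∈ (s : ZFSet.{u}) := by
  simp [sndCoord, Formula.Realize, Fin.snoc]
  constructor
  · rintro ⟨p, hp, ⟨q, hqp, -, hzq⟩, hpM, hz⟩
    obtain ⟨x, y, rfl⟩ := hs p hp
    have hm {q : ZFSet.{u}} (hq : q ∈ ZFSet.pair x y) : q ∈ M := hM.mem_trans hq hpM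
    have h2 : ({x, y} : ZFSet.{u}) ∈ ZFSet.pair x y := by simp [ZFSet.pair]
    have hyM : y ∈ M := hM.mem_trans (show y ∈ ({x, y} : ZFSet.{u}) by simp) (hm h2)
    have hzxy : (z : ZFSet.{u}) = x ∨ (z : ZFSet.{u}) = y := by
      simp only [ZFSet.pair, ZFSet.mem_pair] at hqp
      obtain rfl | rfl := hqp
      · exact Or.inl (by simpa using hzq)
      · simpa using hzq
    suffices (z : ZFSet.{u}) = y from ⟨x, this ▸ hp⟩
    obtain h | h := hzxy
    · have := hz (fun q _ hq => by
        simp only [ZFSet.pair, ZFSet.mem_pair] at hq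
        obtain rfl | rfl := hq <;> simp [h]) _ (hm h2) h2 y hyM (by simp)
      rw [← this]
    · exact h
  · rintro ⟨x, hx⟩
    have hpM := hM.mem_trans hx s.2
    have h2 : ({x, (z : ZFSet.{u})} : ZFSet.{u}) ∈ ZFSet.pair x z := by simp [ZFSet.pair]
    have h1 : ({x} : ZFSet.{u}) ∈ ZFSet.pair x z := by simp [ZFSet.pair]
    refine ⟨_, hx, ⟨_, h2, hM.mem_trans h2 hpM, by simp⟩, hpM, fun h q hqM hq w hw hwq => ?_⟩
    have hzx : (z : ZFSet.{u}) = x := by simpa using h _ (hM.mem_trans h1 hpM) h1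
    ext1
    simp only [ZFSet.pair, ZFSet.mem_pair] at hq
    obtain rfl | rfl := hq
    · simpa [hzx] using hwq
    · simpa [hzx] using hwq

theorem ZFSet.card_lt_of_rank_lt {κ : Cardinal.{u}} (hκ : κ.IsInaccessible) {x : ZFSet.{u}}
    (hx : x.rank < κ.ord) : x.card < κ := by
  refine (ZFSet.card_mono x.subset_vonNeumann_self).trans_lt ?_
  rw [ZFSet.card_vonNeumann, ← hκ.preBeth_ord]
  exact Cardinal.preBeth_strictMono hx

/-- By ∈-induction x ⊆ M, and |x| < κ, so closure puts an enumeration s of x into M. Then x, the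
range of s, is separated from ⋃⋃s. -/
theorem IsKappaModel.mem_of_rank_lt {T : setLang.Theory} {κ : Cardinal.{u}} {M : ZFSet.{u}}
    (h : IsKappaModel T κ M) (hκ : κ.IsInaccessible) (hT : {SetAxioms.union, separation sndCoord} ⊆ T)
    {x : ZFSet.{u}} (hx : x.rank < κ.ord) : x ∈ M := by
  have := h.models
  have hU : M ⊨ SetAxioms.union := Theory.realize_sentence_of_mem T (hT (by simp))
  have hS : M ⊨ separation sndCoord := Theory.realize_sentence_of_mem T (hT (by simp))
  induction x using ZFSet.inductionOn with | _ x ih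
  have hxM : ∀ y ∈ x, y ∈ M := fun y hy => ih y hy ((ZFSet.rank_lt_of_mem hy).trans hx)
  obtain ⟨e⟩ : Nonempty (Iio x.card.ord ≃ x) := by
    rw [← Cardinal.eq, ZFSet.cardinalMk_coe_sort, Cardinal.mk_Iio_ordinal, Cardinal.card_ord]
  let s : ZFSet.{u} := ZFSet.range fun i : Iio x.card.ord =>
    ZFSet.pair (i : Ordinal.{u}).toZFSet (e i : ZFSet.{u})
  have hs : s ∈ M := by
    refine h.closed _ (Cardinal.ord_lt_ord.2 (ZFSet.card_lt_of_rank_lt hκ hx)) s ⟨?_, ?_⟩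
    · intro p hp
      obtain ⟨i, rfl⟩ := ZFSet.mem_range.1 hp
      exact ZFSet.pair_mem_prod.2 ⟨Ordinal.toZFSet_mem_toZFSet_iff.2 i.2, hxM _ (e i).2⟩
    · intro z hz
      obtain ⟨a, ha, rfl⟩ := Ordinal.mem_toZFSet_iff.1 hz
      refine ⟨e ⟨a, ha⟩, ZFSet.mem_range.2 ⟨⟨a, ha⟩, rfl⟩, fun w hw => ?_⟩
      obtain ⟨i, hi⟩ := ZFSet.mem_range.1 hw
      obtain ⟨h1, rfl⟩ := ZFSet.pair_inj.1 hi
      obtain rfl : i = ⟨a, ha⟩ := Subtype.ext (Ordinal.toZFSet_injective h1)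
      rfl
  have hUU := h.transitive.sUnion_mem_of_models hU (h.transitive.sUnion_mem_of_models hU hs)
  obtain ⟨b, hb⟩ := exists_sep_of_models sndCoord hS ⟨s, hs⟩ ⟨_, hUU⟩
  convert b.2 using 1
  have hpair : ∀ p ∈ s, ∃ x y, p = ZFSet.pair x y := by
    intro p hp
    obtain ⟨i, rfl⟩ := ZFSet.mem_range.1 hp
    exact ⟨_, _, rfl⟩
  have hmem (y : M) : (y : ZFSet.{u}) ∈ x ↔ (y : ZFSet.{u}) ∈ (b : ZFSet.{u}) := by
    rw [hb, realize_sndCoord h.transitive hpair]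
    constructor
    · intro hy
      have : ZFSet.pair (e.symm ⟨y, hy⟩ : Ordinal.{u}).toZFSet y ∈ s :=
        ZFSet.mem_range.2 ⟨e.symm ⟨y, hy⟩, by simp⟩
      refine ⟨?_, _, this⟩
      refine ZFSet.mem_sUnion_of_mem
        (z := {(e.symm ⟨y, hy⟩ : Ordinal.{u}).toZFSet, (y : ZFSet.{u})}) ?_
        (ZFSet.mem_sUnion_of_mem ?_ this)
      · simp
      · simp [ZFSet.pair]
    · rintro ⟨-, x', hx'⟩
      obtain ⟨i, hi⟩ := ZFSet.mem_range.1 hx'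
      rw [← (ZFSet.pair_inj.1 hi).2]
      exact (e i).2
  ext y
  exact ⟨fun hy => (hmem ⟨y, hxM y hy⟩).1 hy, fun hy =>
    (hmem ⟨y, h.transitive.mem_trans hy b.2⟩).2 hy⟩

/-! ### Elementary diagrams and their codes -/

/-- Two structures with the same theory in the constants `ι`, which name every element of the
first one, give rise to an elementary embedding. -/
theorem exists_elementaryEmbedding_of_realize_iff {L : FirstOrder.Language.{0, 0}} {M N : Type*}
    [L.Structure M] [L.Structure N] {ι : Type*} (b : ι → M) (b' : ι → N)
    (hb : Function.Surjective b)
    (h : ∀ (n : ℕ) (φ : L.Formula (Fin n)) (v : Fin n → ι), φ.Realize (b ∘ v) → φ.Realize (b' ∘ v)) :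
    ∃ j : M ↪ₑ[L] N, ∀ i, j (b i) = b' i := by
  have h' (n : ℕ) (φ : L.Formula (Fin n)) (v : Fin n → ι) :
      φ.Realize (b' ∘ v) ↔ φ.Realize (b ∘ v) := by
    refine ⟨fun hφ => ?_, h n φ v⟩
    by_contra hn
    exact (Formula.realize_not.1 (h n φ.not v (Formula.realize_not.2 hn))) hφ
  refine ⟨⟨fun x => b' (Function.surjInv hb x), fun n φ x => ?_⟩, fun i => ?_⟩
  · refine (h' n φ (Function.surjInv hb ∘ x)).trans ?_
    rw [← Function.comp_assoc, (Function.rightInverse_surjInv hb).comp_eq_id, Function.id_comp]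
  -- The diagram contains the equations between names, so the image does not depend on the chosen
  -- name.
  · have := h 2 ((Term.var 0).equal (Term.var 1)) ![Function.surjInv hb (b i), i]
    simp only [Formula.realize_equal, Term.realize_var, Function.comp] at this
    exact this (Function.surjInv_eq hb _)

theorem ZFSet.IsTransitive.exists_rank_eq {M : ZFSet.{u}} (hM : M.IsTransitive) {o : Ordinal.{u}}
    (ho : o < M.rank) : ∃ y ∈ M, y.rank = o := by
  have key : ∀ y : ZFSet.{u}, y ∈ M → o ≤ y.rank → ∃ y ∈ M, y.rank = o := by
    intro y
    induction y using ZFSet.inductionOn with | _ y ih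
    intro hy hoy
    obtain rfl | hlt := hoy.eq_or_lt
    · exact ⟨y, hy, rfl⟩
    · obtain ⟨z, hz, hoz⟩ := ZFSet.lt_rank_iff.1 hlt
      exact ih z hz (hM.mem_trans hz hy) hoz
  obtain ⟨y, hy, hoy⟩ := ZFSet.lt_rank_iff.1 ho
  exact key y hy hoy

theorem ZFSet.IsTransitive.card_rank_le {M : ZFSet.{u}} (hM : M.IsTransitive) :
    M.rank.card ≤ M.card := by
  rw [← Cardinal.lift_le.{u + 1}, ← Cardinal.mk_Iio_ordinal, ← ZFSet.cardinalMk_coe_sort]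
  choose f hf hf' using fun o : Iio M.rank => hM.exists_rank_eq o.2
  refine Cardinal.mk_le_of_injective (f := fun o => (⟨f o, hf o⟩ : M)) fun a b hab => ?_
  have hab' : f a = f b := congrArg Subtype.val hab
  exact Subtype.ext (by rw [← hf' a, ← hf' b, hab'])

theorem ZFSet.IsTransitive.mem_vonNeumann_ord {M : ZFSet.{u}} (hM : M.IsTransitive)
    {κ : Cardinal.{u}} (h : M.card < κ) : M ∈ V_ κ.ord :=
  ZFSet.mem_vonNeumann.2 (Cardinal.lt_ord.2 (hM.card_rank_le.trans_lt h))

/-- If |α| < α, closure would give 2^|α| ≤ |α|, against Cantor. -/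
theorem Ordinal.ord_card_eq_of_forall_lt {α : Ordinal.{u}}
    (h : ∀ δ < α, (2 ^ δ.card : Cardinal.{u}).ord < α) :
    α = α.card.ord ∧ α.card.IsStrongPrelimit := by
  have heq : α = α.card.ord := by
    refine ((Cardinal.ord_card_le α).eq_or_lt.resolve_right fun hlt => ?_).symm
    have := Ordinal.card_le_card (h _ hlt).le
    rw [Cardinal.card_ord, Cardinal.card_ord] at this
    exact this.not_gt (Cardinal.cantor _)
  refine ⟨heq, fun x hx => ?_⟩
  have := h x.ord (by rw [heq]; exact Cardinal.ord_lt_ord.2 hx)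
  rw [Cardinal.card_ord, heq, Cardinal.ord_lt_ord] at this
  exact this

/-- The tags of the codes below. -/
abbrev CodeTag : Type := Fin 3 ⊕ Σ n, setLang.Formula (Fin n)

instance : Countable setLang.Symbols := by
  have h1 : Countable (Σ n, setLang.Functions n) := ⟨fun x => x.2.elim, fun x => x.2.elim⟩
  have h2 : Countable (Σ n, setLang.Relations n) :=
    ⟨fun _ => 0, by rintro ⟨_, ⟨⟩⟩ ⟨_, ⟨⟩⟩ _; rfl⟩
  exact inferInstanceAs (Countable ((Σ n, setLang.Functions n) ⊕ Σ n, setLang.Relations n))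

/-- The code of a map `f` on the ordinals below `l`. -/
def mapCode {X : Type*} [LT X] (l : X) (f : X → X) : Set (CodeTag × List X) :=
  {x | x = (Sum.inl 0, [l]) ∨ ∃ ξ < l, x = (Sum.inl 0, [ξ, f ξ])}

/-- The elementary diagram of `M`, whose elements are named by the ordinals below `γ`, together
with the information which ordinals name `γ` and the elements of `γ`. -/
def modelCode {κ : Cardinal.{u}} (γ : Iio κ.ord) {M : ZFSet.{u}} (b : Iio κ.ord → M) :
    Set (CodeTag × List (Iio κ.ord)) :=
  {x | (∃ ξ < γ, x = (Sum.inl 1, [ξ]) ∧ (b ξ : ZFSet.{u}) = (γ : Ordinal.{u}).toZFSet) ∨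
    (∃ ξ < γ, ∃ δ < γ, x = (Sum.inl 2, [ξ, δ]) ∧ (b ξ : ZFSet.{u}) = (δ : Ordinal.{u}).toZFSet) ∨
    ∃ (n : ℕ) (φ : setLang.Formula (Fin n)) (v : Fin n → Iio κ.ord), (∀ i, v i < γ) ∧
      x = (Sum.inr ⟨n, φ⟩, List.ofFn v) ∧ φ.Realize (b ∘ v)}

theorem realize_of_mem_modelCode {κ : Cardinal.{u}} {γ : Iio κ.ord} {M : ZFSet.{u}}
    {b : Iio κ.ord → M} {n : ℕ} {φ : setLang.Formula (Fin n)} {v : Fin n → Iio κ.ord}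
    (h : ((Sum.inr ⟨n, φ⟩, List.ofFn v) : CodeTag × List (Iio κ.ord)) ∈ modelCode γ b) :
    φ.Realize (b ∘ v) := by
  obtain ⟨_, _, h, _⟩ | ⟨_, _, _, _, h, _⟩ | ⟨m, ψ, w, -, h, hr⟩ := h
  · simp at h
  · simp at h
  · simp only [Prod.mk.injEq, Sum.inr.injEq, Sigma.mk.injEq] at h
    obtain ⟨⟨rfl, h1⟩, h2⟩ := h
    obtain rfl := eq_of_heq h1
    rwa [List.ofFn_injective h2]

/-- Tag 1 makes the name of α in M a name of β in N, so j(α) = β; tag 2 makes the names of each δ <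
α agree, so j fixes δ. -/
theorem exists_embedding_of_modelCode {κ : Cardinal.{u}} {α β : Iio κ.ord} {M N : ZFSet.{u}}
    {b : Iio κ.ord → M} {b' : Iio κ.ord → N} (hα : (α : Ordinal.{u}).toZFSet ∈ M) (hαβ : α < β)
    (hN : N.IsTransitive) (hb : ∀ m, ∃ ξ < α, b ξ = m)
    (hcode : modelCode α b ⊆ modelCode β b') :
    ∃ j : M ↪ₑ[setLang] N, IsUnfoldabilityEmbedding (α : Ordinal.{u}) (β : Ordinal.{u}) j := by
  obtain ⟨j, hj⟩ := exists_elementaryEmbedding_of_realize_iff (L := setLang)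
    (fun ξ : Iio α => b ξ) (fun ξ => b' ξ)
    (fun m => by obtain ⟨ξ, h, rfl⟩ := hb m; exact ⟨⟨ξ, h⟩, rfl⟩) (fun n φ v hφ =>
      realize_of_mem_modelCode (v := fun i => v i)
        (hcode (Or.inr (Or.inr ⟨n, φ, _, fun i => (v i).2, rfl, hφ⟩))))
  have hjα (h : (α : Ordinal.{u}).toZFSet ∈ M) :
      (j ⟨_, h⟩ : ZFSet.{u}) = (β : Ordinal.{u}).toZFSet := by
    obtain ⟨ξ, hξ, hbξ⟩ := hb ⟨_, h⟩
    obtain ⟨η, _, he, hη⟩ | ⟨_, _, _, _, h, _⟩ | ⟨_, _, _, _, h, _⟩ :=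
      hcode (Or.inl ⟨ξ, hξ, rfl, by rw [hbξ]⟩)
    · obtain rfl : ξ = η := by simpa using he
      rw [← hη, ← hbξ]
      exact congrArg Subtype.val (hj ⟨ξ, hξ⟩)
    · simp at h
    · simp at h
  refine ⟨j, hN, ⟨⟨hα, ?_⟩, fun δ hδ h => ?_⟩, fun h => (hjα h).ge⟩
  · rw [hjα]
    exact fun h => hαβ.ne' (Subtype.ext (Ordinal.toZFSet_injective h))
  · obtain ⟨ξ, hξ, hbξ⟩ := hb ⟨_, h⟩
    obtain ⟨_, _, h, _⟩ | ⟨η, _, ε, _, he, hη⟩ | ⟨_, _, _, _, h, _⟩ :=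
      hcode (Or.inr (Or.inl ⟨ξ, hξ, ⟨δ, hδ.trans α.2⟩, hδ, rfl, by rw [hbξ]⟩))
    · simp at h
    · obtain ⟨rfl, rfl⟩ : ξ = η ∧ (⟨δ, hδ.trans α.2⟩ : Iio κ.ord) = ε := by simpa using he
      rw [← hbξ]
      exact (congrArg Subtype.val (hj ⟨ξ, hξ⟩)).trans hη
    · simp at h

theorem exists_cofinal_map {κ : Cardinal.{u}} {γ : Iio κ.ord}
    (h : (γ : Ordinal.{u}).cof.ord < γ) :
    ∃ l < γ, ∃ f : Iio κ.ord → Iio κ.ord, (∀ ξ < l, f ξ < γ) ∧ ∀ δ < γ, ∃ ξ < l, δ ≤ f ξ := by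
  obtain ⟨S, hS, hcard⟩ := Order.exists_cof_eq (Iio (γ : Ordinal.{u}))
  obtain ⟨e⟩ : Nonempty (Iio (γ : Ordinal.{u}).cof.ord ≃ S) := by
    rw [← Cardinal.eq, hcard, Ordinal.cof_Iio, ← Ordinal.lift_cof, Cardinal.mk_Iio_ordinal,
      Cardinal.card_ord]
  classical
  refine ⟨⟨_, h.trans γ.2⟩, h, fun ξ => if hξ : (ξ : Ordinal.{u}) ∈ Iio (γ : Ordinal.{u}).cof.ord then
    ⟨(e ⟨ξ, hξ⟩).1.1, lt_trans (mem_Iio.1 (e ⟨ξ, hξ⟩).1.2) γ.2⟩ else ξ,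
    fun ξ hξ => ?_, fun δ hδ => ?_⟩
  · beta_reduce
    rw [dif_pos (show (ξ : Ordinal.{u}) ∈ Iio (γ : Ordinal.{u}).cof.ord from hξ)]
    exact (e ⟨ξ, hξ⟩).1.2
  · obtain ⟨s, hs, hδs⟩ := hS ⟨δ, hδ⟩
    have hlt := (e.symm ⟨s, hs⟩).2
    refine ⟨⟨e.symm ⟨s, hs⟩, lt_trans hlt (h.trans γ.2)⟩, hlt, ?_⟩
    beta_reduce
    rw [dif_pos hlt]
    simpa [← Subtype.coe_le_coe] using hδs

theorem exists_surjOn_Iio {κ : Cardinal.{u}} {γ : Iio κ.ord} {M : ZFSet.{u}}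
    (h : M.card = (γ : Ordinal.{u}).card) (hM : (γ : Ordinal.{u}).toZFSet ∈ M) :
    ∃ b : Iio κ.ord → M, ∀ m, ∃ ξ < γ, b ξ = m := by
  obtain ⟨e⟩ : Nonempty (Iio (γ : Ordinal.{u}) ≃ M) := by
    rw [← Cardinal.eq, ZFSet.cardinalMk_coe_sort, Cardinal.mk_Iio_ordinal, h]
  classical
  refine ⟨fun ξ => if hξ : (ξ : Ordinal.{u}) ∈ Iio (γ : Ordinal.{u}) then e ⟨ξ, hξ⟩ else ⟨_, hM⟩, fun m => ?_⟩
  have hlt := (e.symm m).2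
  refine ⟨⟨e.symm m, lt_trans (mem_Iio.1 hlt) γ.2⟩, hlt, ?_⟩
  beta_reduce
  rw [dif_pos hlt]
  simp

/-! ### The main argument -/

/-- A subtle cardinal `κ` has, in every club, a cardinal that is `θ`-strongly unfoldable for all
`θ < κ`, with targets of the embeddings in `V_κ`. -/
theorem IsSubtle.exists_stronglyUnfoldable {T : setLang.Theory}
    (hT : {SetAxioms.union, separation sndCoord} ⊆ T) {κ : Cardinal.{u}} (h : IsSubtle κ)
    {C : Set (Iio κ.ord)} (hC : IsClub C) :
    ∃ γ ∈ C, ∃ c : Cardinal.{u}, (γ : Ordinal.{u}) = c.ord ∧ c.IsInaccessible ∧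
      ∀ θ < κ.ord, ∀ M, IsKappaModel T c M → ∃ N ∈ V_ κ.ord, ∃ j : M ↪ₑ[setLang] N,
        IsUnfoldabilityEmbedding c.ord θ j ∧ V_ θ ⊆ N := by
  by_contra! H
  have hreg := h.isRegular
  have hlim := Cardinal.noMaxOrder_Iio_ord h.aleph0_lt.le
  have hcof : Order.cof (Iio κ.ord) ≠ Cardinal.aleph0 := by
    rw [Ordinal.cof_Iio, ← Ordinal.lift_cof, hreg.cof_ord]
    simpa using h.aleph0_lt.ne'
  let pw (δ : Iio κ.ord) : Iio κ.ord := ⟨(2 ^ (δ : Ordinal.{u}).card : Cardinal.{u}).ord,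
    Cardinal.ord_lt_ord.2 (h.isStrongPrelimit (Cardinal.lt_ord.1 δ.2))⟩
  let w : Iio κ.ord := ⟨Cardinal.aleph0.ord, Cardinal.ord_lt_ord.2 h.aleph0_lt⟩
  let C₀ := (C ∩ {α | ∀ δ < α, pw δ < α}) ∩ Ioi w
  have hC₀ : IsClub C₀ := (hC.inter hcof (isClub_closurePoints hreg h.aleph0_lt pw)).inter hcof
    (isClub_Ioi w)
  have hcard {γ} (hγ : γ ∈ C₀) : (γ : Ordinal.{u}) = (γ : Ordinal.{u}).card.ord ∧
      (γ : Ordinal.{u}).card.IsStrongPrelimit ∧ Cardinal.aleph0 < (γ : Ordinal.{u}).card := by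
    obtain ⟨h1, h2⟩ := Ordinal.ord_card_eq_of_forall_lt (α := (γ : Ordinal.{u}))
      fun δ hδ => hγ.1.2 ⟨δ, hδ.trans γ.2⟩ hδ
    refine ⟨h1, h2, ?_⟩
    rw [← Cardinal.ord_lt_ord, ← h1]
    exact hγ.2
  have hex : ∀ γ ∈ C₀, ∃ (A : Set (CodeTag × List (Iio κ.ord))) (θ : Iio κ.ord),
      (∀ x ∈ A, ∀ ξ ∈ x.2, ξ < γ) ∧
      ((∃ l < γ, ∃ f : Iio κ.ord → Iio κ.ord, (∀ ξ < l, f ξ < γ) ∧ (∀ δ < γ, ∃ ξ < l, δ ≤ f ξ) ∧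
        A = mapCode l f) ∨
      ((γ : Ordinal.{u}).card.IsInaccessible ∧ ∃ (M : ZFSet.{u}) (b : Iio κ.ord → M),
        IsKappaModel T (γ : Ordinal.{u}).card M ∧ (∀ m, ∃ ξ < γ, b ξ = m) ∧ A = modelCode γ b ∧
        ∀ N ∈ V_ κ.ord, ∀ j : M ↪ₑ[setLang] N,
          IsUnfoldabilityEmbedding (γ : Ordinal.{u}) θ j → ¬ V_ θ ⊆ N)) := by
    intro γ hγ
    obtain ⟨h1, h2, h3⟩ := hcard hγ
    by_cases hr : (γ : Ordinal.{u}).card ≤ (γ : Ordinal.{u}).card.ord.cof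
    · obtain ⟨θ, hθ, M, hM, hbad⟩ := H γ hγ.1.1 _ h1 ⟨h3, hr, h2⟩
      rw [← h1] at hbad
      have hmem := hM.mem
      rw [← h1] at hmem
      obtain ⟨b, hb⟩ := exists_surjOn_Iio hM.card_eq hmem
      refine ⟨modelCode γ b, ⟨θ, hθ⟩, ?_, Or.inr ⟨⟨h3, hr, h2⟩, M, b, hM, hb, rfl, hbad⟩⟩
      rintro x (⟨ξ, hξ, rfl, -⟩ | ⟨ξ, hξ, δ, hδ, rfl, -⟩ | ⟨n, φ, v, hv, rfl, -⟩)
      · simpa using hξ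
      · simpa using ⟨hξ, hδ⟩
      · simpa [List.mem_ofFn] using hv
    · rw [← h1, not_le, ← Cardinal.ord_lt_ord, ← h1] at hr
      obtain ⟨l, hl, f, hf, hf'⟩ := exists_cofinal_map hr
      refine ⟨mapCode l f, w, ?_, Or.inl ⟨l, hl, f, hf, hf', rfl⟩⟩
      rintro x (rfl | ⟨ξ, hξ, rfl⟩)
      · simpa using hl
      · simpa using ⟨hξ.trans hl, hf ξ hξ⟩
  choose! A θ hA hAθ using hex
  obtain ⟨α, hα, β, hβ, hlt, heq⟩ := h.exists_lt_of_list
    (hC₀.inter hcof (isClub_closurePoints hreg h.aleph0_lt θ)) A fun α hα => hA α hα.1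
  have hsub : A α ⊆ A β := fun x hx => ((heq x).1 hx).1
  obtain ⟨l, hl, f, hf, -, hAα⟩ | ⟨-, M, b, hM, hb, hAα, hbad⟩ := hAθ α hα.1 <;>
  obtain ⟨l', hl', f', -, hf', hAβ⟩ | ⟨hin, N, b', hN, hb', hAβ, -⟩ := hAθ β hβ.1 <;>
  rw [hAα, hAβ] at hsub
  -- Both singular: `f'` extends `f` on the same domain, but reaches α there, while `f` stays below
  -- α.
  · obtain rfl : l = l' := by
      obtain h1 | ⟨_, _, h1⟩ := hsub (Or.inl rfl)
      · simpa using h1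
      · simp at h1
    obtain ⟨ξ, hξ, hle⟩ := hf' α hlt
    obtain h1 | ⟨η, _, h1⟩ := hsub (Or.inr ⟨ξ, hξ, rfl⟩)
    · simp at h1
    · obtain ⟨rfl, h2⟩ : ξ = η ∧ f ξ = f' η := by simpa using h1
      exact (hle.trans_lt (h2 ▸ hf ξ hξ)).false
  · obtain ⟨_, _, h1, _⟩ | ⟨_, _, _, _, h1, _⟩ | ⟨_, _, _, _, h1, _⟩ := hsub (Or.inl rfl) <;>
    simp at h1
  · have hmem := hM.mem
    rw [← (hcard hα.1).1] at hmem
    obtain ⟨ξ, hξ, hbξ⟩ := hb ⟨_, hmem⟩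
    obtain h1 | ⟨_, _, h1⟩ := hsub (Or.inl ⟨ξ, hξ, rfl, by rw [hbξ]⟩) <;> simp at h1
  -- Both inaccessible: the embedding of `M` into the β-model `N` is one that the choice of `M` and
  -- `θ α` forbids.
  · have hmem := hM.mem
    rw [← (hcard hα.1).1] at hmem
    obtain ⟨j, hj⟩ := exists_embedding_of_modelCode hmem hlt hN.transitive hb hsub
    have hθβ : θ α < β := hβ.2 α hlt
    refine hbad N (hN.transitive.mem_vonNeumann_ord ?_) j ⟨hj.transitive, hj.crit, fun h => ?_⟩ ?_
    · rw [hN.card_eq]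
      exact Cardinal.lt_ord.1 β.2
    · exact (Ordinal.toZFSet_subset_toZFSet_iff.2 (Subtype.coe_le_coe.2 hθβ.le)).trans
        (hj.le_image h)
    · intro x hx
      refine hN.mem_of_rank_lt hin hT ((ZFSet.mem_vonNeumann.1 hx).trans ?_)
      rw [← (hcard hβ.1).1]
      exact hθβ

/-! ### Transfer to V_κ -/

theorem ZFSet.prod_mem_vonNeumann {o : Ordinal.{u}} (ho : Order.IsSuccLimit o) {x y : ZFSet.{u}}
    (hx : x ∈ V_ o) (hy : y ∈ V_ o) : ZFSet.prod x y ∈ V_ o := by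
  have h : ZFSet.prod x y ⊆ ZFSet.powerset (ZFSet.powerset (x ∪ y)) := by
    intro z hz
    obtain ⟨a, ha, b, hb, rfl⟩ := ZFSet.mem_prod.1 hz
    rw [ZFSet.mem_powerset]
    intro w hw
    rw [ZFSet.mem_powerset]
    intro v hv
    simp only [ZFSet.pair, ZFSet.mem_pair] at hw
    obtain rfl | rfl := hw
    · obtain rfl := ZFSet.mem_singleton.1 hv
      exact ZFSet.mem_union.2 (Or.inl ha)
    · obtain rfl | rfl := ZFSet.mem_pair.1 hv
      · exact ZFSet.mem_union.2 (Or.inl ha)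
      · exact ZFSet.mem_union.2 (Or.inr hb)
  refine ZFSet.mem_vonNeumann_of_subset h ?_
  rw [ZFSet.mem_vonNeumann] at *
  simp only [ZFSet.rank_powerset, ZFSet.rank_union]
  exact ho.succ_lt (ho.succ_lt (max_lt hx hy))

theorem Cardinal.IsInaccessible.isInaccessibleIn {c : Cardinal.{u}} (hc : c.IsInaccessible)
    {W : Set ZFSet.{u}} (hW : c.ord.toZFSet ∈ W) : IsInaccessibleIn W c.ord := by
  refine ⟨hW, ?_, fun α hα f _ hf => ?_, ?_⟩
  · simpa using Cardinal.ord_lt_ord.2 hc.aleph0_lt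
  · choose! g hg _ using hf.2
    have hgc (ξ : Iio α) : (g (ξ : Ordinal.{u}).toZFSet).rank < c.ord := by
      have := (ZFSet.pair_mem_prod.1 (hf.1 (hg _ (Ordinal.toZFSet_mem_toZFSet_iff.2 ξ.2)))).2
      simpa using ZFSet.rank_lt_of_mem this
    obtain ⟨b, hb⟩ := hc.isRegular.exists_forall_lt
      (s := range fun ξ : Iio α => (⟨_, hgc ξ⟩ : Iio c.ord)) (by
        refine Cardinal.mk_range_le.trans_lt ?_
        rw [Cardinal.mk_Iio_ordinal, Cardinal.lift_lt]
        exact Cardinal.lt_ord.1 hα)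
    refine ⟨b, b.2, fun x y hxy => ?_⟩
    obtain ⟨hx, hy⟩ := ZFSet.pair_mem_prod.1 (hf.1 hxy)
    obtain ⟨ξ, hξ, rfl⟩ := Ordinal.mem_toZFSet_iff.1 hx
    obtain ⟨η, hη, rfl⟩ := Ordinal.mem_toZFSet_iff.1 hy
    have h1 := hb _ ⟨⟨ξ, hξ⟩, rfl⟩
    have h2 : g ξ.toZFSet = η.toZFSet := ((hf.2 _ hx).unique (hg _ hx) hxy)
    rw [Ordinal.toZFSet_mem_toZFSet_iff]
    simpa [h2, ← Subtype.coe_lt_coe] using h1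
  · rintro α hα ⟨f, -, hf, hsurj⟩
    choose! g _ hg hgf using hsurj
    have hle : Cardinal.mk (Iio c.ord) ≤ Cardinal.mk (ZFSet.powerset α.toZFSet) := by
      refine Cardinal.mk_le_of_injective
        (f := fun β => ⟨g β, ZFSet.mem_powerset.2 (hg β β.2)⟩) fun β β' h => ?_
      have h' : g β = g β' := congrArg Subtype.val h
      have h1 := hgf β β.2
      rw [h'] at h1
      exact Subtype.ext (Ordinal.toZFSet_injective (hf _ _ _ h1 (hgf β' β'.2)))
    rw [ZFSet.cardinalMk_coe_sort, Cardinal.mk_Iio_ordinal, Cardinal.lift_le, Cardinal.card_ord,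
      ZFSet.card_powerset, Ordinal.card_toZFSet] at hle
    exact hle.not_gt (hc.isStrongPrelimit (Cardinal.lt_ord.1 hα))

/-- A sequence of length α in M is a subset of α × M, which is in V_o as o is a limit; so V_o misses
no short sequence. -/
theorem IsKappaModelIn.isKappaModel {T : setLang.Theory} {o : Ordinal.{u}}
    (ho : Order.IsSuccLimit o) {c : Cardinal.{u}} {M : ZFSet.{u}} (hc : c.ord < o)
    (h : IsKappaModelIn T (V_ o : Set ZFSet.{u}) c.ord M) : IsKappaModel T c M := by
  refine ⟨h.transitive, ?_, h.mem, h.models, fun α hα s hs => h.closed α hα s ?_ hs⟩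
  · obtain ⟨b, -, hb, hb'⟩ := h.card_eq
    choose! g hg hu using hb'
    have hgc (y : M) : g y ∈ c.ord.toZFSet := (ZFSet.pair_mem_prod.1 (hb.1 (hg y y.2))).1
    have h1 : Cardinal.mk M = Cardinal.mk c.ord.toZFSet := by
      refine Cardinal.mk_congr (Equiv.ofBijective (fun y => ⟨g y, hgc y⟩) ⟨fun y y' hy => ?_, ?_⟩)
      · have hy' : g y = g y' := congrArg Subtype.val hy
        have h2 := hg y y.2
        rw [hy'] at h2
        exact Subtype.ext ((hb.2 _ (hgc y')).unique h2 (hg y' y'.2))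
      · rintro ⟨x, hx⟩
        obtain ⟨y, hy, -⟩ := hb.2 x hx
        have hyM := (ZFSet.pair_mem_prod.1 (hb.1 hy)).2
        exact ⟨⟨y, hyM⟩, Subtype.ext (hu y hyM x hy).symm⟩
    simpa [ZFSet.cardinalMk_coe_sort] using h1
  · refine ZFSet.mem_vonNeumann_of_subset hs.1 (ZFSet.prod_mem_vonNeumann ho ?_ h.mem_class)
    exact ZFSet.mem_vonNeumann.2 (by simpa using hα.trans hc)

theorem IsStationary.isCofinal {X : Type*} [LinearOrder X] {s : Set X} (hs : IsStationary s) :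
    IsCofinal s := by
  intro a
  obtain ⟨b, hb, hab⟩ := hs (t := Ici a) ⟨fun d hd ⟨y, hy⟩ _ x hx => le_trans (hd hy) (hx.1 hy),
    fun b => ⟨max a b, le_max_left _ _, le_max_right _ _⟩⟩
  exact ⟨b, hb, hab⟩

theorem mainTheorem10 :
    ∃ T₀ : setLang.Theory, T₀.Finite ∧ T₀ ⊆ ZFC ∧
      ∀ T : setLang.Theory, T.Finite → T₀ ⊆ T → T ⊆ ZFC →
        ∀ κ : Cardinal.{u}, IsSubtle κ →
          IsStationary {γ : Iio κ.ord |
              ∃ c : Cardinal.{u}, (γ : Ordinal.{u}) = c.ord ∧ IsLTStronglyUnfoldable T c κ.ord} ∧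
            IsStationary {γ : Iio κ.ord |
              IsStronglyUnfoldableIn T (V_ κ.ord : Set ZFSet.{u}) (γ : Ordinal.{u})} ∧
            IsCofinal {γ : Iio κ.ord |
              IsStronglyUnfoldableIn T (V_ κ.ord : Set ZFSet.{u}) (γ : Ordinal.{u})} := by
  refine ⟨{SetAxioms.union, separation sndCoord}, by simp, ?_, fun T _ hT _ κ hκ => ?_⟩
  · rintro _ (rfl | rfl)
    · exact Or.inl (Or.inl (by simp))
    · exact Or.inl (Or.inr ⟨1, sndCoord, rfl⟩)
  have hlim := Cardinal.isSuccLimit_ord hκ.aleph0_lt.le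
  have h2 : IsStationary {γ : Iio κ.ord |
      IsStronglyUnfoldableIn T (V_ κ.ord : Set ZFSet.{u}) (γ : Ordinal.{u})} := by
    intro C hC
    obtain ⟨γ, hγ, c, hc, hin, h⟩ := hκ.exists_stronglyUnfoldable hT hC
    refine ⟨γ, fun θ hθ => ?_, hγ⟩
    have hcκ : c.ord < κ.ord := hc ▸ γ.2
    rw [hc]
    refine ⟨hin.isInaccessibleIn (ZFSet.mem_vonNeumann.2 (by simpa using hcκ)), fun M hM hM' => ?_⟩
    obtain ⟨N, hN, j, hj, hθN⟩ := h θ (by simpa using ZFSet.mem_vonNeumann.1 hθ) M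
      (hM'.isKappaModel hlim hcκ)
    -- The graph of j is a subset of M × N, hence an element of V_κ; `Shrink` brings its index type
    -- down to universe `u`.
    refine ⟨N, hN, j, ⟨ZFSet.range fun x : Shrink.{u} M =>
      ZFSet.pair ((equivShrink M).symm x : ZFSet.{u}) (j ((equivShrink M).symm x)), ?_, ?_⟩, hj,
      fun x _ hx => hθN (ZFSet.mem_vonNeumann.2 hx)⟩
    · refine ZFSet.mem_vonNeumann_of_subset ?_ (ZFSet.prod_mem_vonNeumann hlim hM hN)
      intro p hp
      obtain ⟨x, rfl⟩ := ZFSet.mem_range.1 hp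
      exact ZFSet.pair_mem_prod.2 ⟨Subtype.prop _, Subtype.prop _⟩
    · intro p
      rw [ZFSet.mem_range, (equivShrink M).symm.exists_congr_left]
      simp [eq_comm]
  refine ⟨fun C hC => ?_, h2, h2.isCofinal⟩
  obtain ⟨γ, hγ, c, hc, hin, h⟩ := hκ.exists_stronglyUnfoldable hT hC
  refine ⟨γ, ⟨c, hc, fun θ hθ => ⟨hin, fun M hM => ?_⟩⟩, hγ⟩
  obtain ⟨N, -, j, hj, hθN⟩ := h θ hθ M hM
  exact ⟨N, j, hj, hθN⟩
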